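/- For bounded complex sequences $a=(a_n)_{n\in\mathbb Z}$, $b=(b_n)_{n\in\mathbb Z}$, $c=(c_n)_{n\in\mathbb Z}$ let $J$ be the Jacobi operator on $\ell^2(\mathbb Z)$ given by $$(Ju)_n=a_{n-1}u_{n-1}+b_nu_n+c_nu_{n+1},\qquad n\in\mathbb Z,$$ and put $v_n=\max\{|a_{n-1}-1|,|a_n-1|,|b_n|,|c_{n-1}-1|,|c_n-1|\}$. Let $\sigma_{\rm d}(J)$ be the discrete spectrum of $J$, i.e. the set of isolated points of the spectrum of $J$ that are eigenvalues of finite algebraic multiplicity; in sums over $\sigma_{\rm d}(J)$ each eigenvalue is repeated according to its algebraic multiplicity. Let $p\ge 1$ and let $\varphi:(0,\pi/2)\to(0,\infty)$ be a continuous function such that $\varphi(\omega)/\tan^p(\omega)\to 0$ as $\omega\to\frac{\pi}{2}^-$. Then $$\limsup_{\omega\to\frac{\pi}{2}^-}\ \sup_{0\ne v\in\ell^p(\mathbb Z)}\ \frac{1}{\varphi(\omega)\,\|v\|_{\ell^p}^p}\sum_{\substack{\lambda\in\sigma_{\rm d}(J)\\ 2-\operatorname{Re}\lambda<\tan(\omega)\,|\operatorname{Im}\lambda|}}|\lambda-2|^{p-1/2}=\infty,$$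 where the supremum is taken over all bounded complex sequences $a,b,c$ whose associated sequence $v$ is non-zero and belongs to $\ell^p(\mathbb Z)$. -/

import Mathlib

open scoped ENNReal Topology lp

noncomputable section

namespace JacobiLT

/-- The translation `(shift k u) n = u (n + k)` on `ℓ²(ℤ)`. -/
def shift (k : ℤ) : ℓ²(ℤ, ℂ) →L[ℂ] ℓ²(ℤ, ℂ) :=
  LinearMap.mkContinuous
    { toFun := fun u => ⟨fun n => u (n + k), by
        have h := (lp.memℓp u).summable (by norm_num : (0 : ℝ) < (2 : ℝ≥0∞).toReal)
        exact memℓp_gen ((Equiv.addRight k).summable_iff.mpr h)⟩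
      map_add' := fun _ _ => rfl
      map_smul' := fun _ _ => rfl } 1
    (fun u => by
      have h2 : (0 : ℝ) < (2 : ℝ≥0∞).toReal := by norm_num
      rw [one_mul, lp.norm_eq_tsum_rpow h2, lp.norm_eq_tsum_rpow h2]
      exact le_of_eq (congrArg (fun t : ℝ => t ^ (1 / (2 : ℝ≥0∞).toReal))
        ((Equiv.addRight k).tsum_eq (fun n => ‖u n‖ ^ (2 : ℝ≥0∞).toReal))))

/-- Pointwise multiplication of a square-summable sequence by a bounded sequence. -/
def mulOp (a : ℓ^∞(ℤ, ℂ)) : ℓ²(ℤ, ℂ) →L[ℂ] ℓ²(ℤ, ℂ) :=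
  lp.holderL 2 (K := 1) (fun _ : ℤ => ContinuousLinearMap.mul ℂ ℂ)
    (fun _ => ContinuousLinearMap.opNorm_mul_le ℂ ℂ) a

/-- The Jacobi operator on `ℓ²(ℤ)` with bounded complex coefficient sequences `a`, `b`, `c`;
its action is made explicit in `jacobi_apply`. -/
def jacobi (a b c : ℓ^∞(ℤ, ℂ)) : ℓ²(ℤ, ℂ) →L[ℂ] ℓ²(ℤ, ℂ) :=
  shift (-1) ∘L mulOp a + mulOp b + mulOp c ∘L shift 1

theorem jacobi_apply (a b c : ℓ^∞(ℤ, ℂ)) (u : ℓ²(ℤ, ℂ)) (n : ℤ) :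
    jacobi a b c u n = a (n - 1) * u (n - 1) + b n * u n + c n * u (n + 1) := rfl

/-- The sequence `vₙ = max {|aₙ₋₁ - 1|, |aₙ - 1|, |bₙ|, |cₙ₋₁ - 1|, |cₙ - 1|}`. -/
def deviation (a b c : ℓ^∞(ℤ, ℂ)) (n : ℤ) : ℝ :=
  max ‖a (n - 1) - 1‖ (max ‖a n - 1‖ (max ‖b n‖ (max ‖c (n - 1) - 1‖ ‖c n - 1‖)))

section Spectrum

variable {H : Type*} [NormedAddCommGroup H] [NormedSpace ℂ H]

/-- The circle of radius `r > 0` about `l` separates the spectral point `l` of `T` from the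
rest of the spectrum. -/
def IsIsolatingRadius (T : H →L[ℂ] H) (l : ℂ) (r : ℝ) : Prop :=
  0 < r ∧ spectrum ℂ T ∩ Metric.closedBall l r = {l}

open Classical in
/-- The Riesz projection `(2πi)⁻¹ ∮ (z - T)⁻¹ dz` of `T` at an isolated point `l` of its spectrum,
the integral being over a circle about `l` that encloses no other point of the spectrum (by
Cauchy's theorem it does not matter which one). It is `0` if `l` is not an isolated point. -/
def rieszProjection (T : H →L[ℂ] H) (l : ℂ) : H →L[ℂ] H :=
  if h : ∃ r : ℝ, IsIsolatingRadius T l r then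
    (2 * Real.pi * Complex.I : ℂ)⁻¹ • ∮ z in C(l, h.choose), resolvent T z
  else 0

/-- The algebraic multiplicity of an isolated point of the spectrum (as a natural number,
`0` if it is infinite). -/
def algMultiplicity (T : H →L[ℂ] H) (l : ℂ) : ℕ :=
  Module.finrank ℂ (rieszProjection T l).range

/-- The discrete spectrum: the eigenvalues that are isolated points of the spectrum and have finite
algebraic multiplicity. -/
def discreteSpectrum (T : H →L[ℂ] H) : Set ℂ :=
  {l | Module.End.HasEigenvalue (T : H →ₗ[ℂ] H) l ∧ (∃ r : ℝ, IsIsolatingRadius T l r) ∧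
    FiniteDimensional ℂ (rieszProjection T l).range}

end Spectrum

/-- The sum of `|l - 2| ^ (p - 1/2)` over the discrete eigenvalues `l` of `T` with
`2 - Re l < tan ω |Im l|`, each repeated according to its algebraic multiplicity. -/
def sectorSum (p ω : ℝ) (T : ℓ²(ℤ, ℂ) →L[ℂ] ℓ²(ℤ, ℂ)) : ℝ≥0∞ :=
  ∑' l : {l : ℂ // l ∈ discreteSpectrum T ∧ 2 - l.re < Real.tan ω * |l.im|},
    (algMultiplicity T l : ℝ≥0∞) * ENNReal.ofReal (‖(l : ℂ) - 2‖ ^ (p - 1 / 2))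

end JacobiLT

end

/-! For each `ω` near `π/2` one operator violates the bound. Put `h = 4 / tan ω`, let `b = i h` on a
block `{1, …, N}` and `0` elsewhere, and let `a = c = 1` except for zeros at `0` and `N`, which
decouple the block. The block is a finite free Jacobi matrix shifted by `i h`, with eigenvalues `2
cos (jπ/(N+1)) + i h`. All of them lie in the sector, because `2 - 2 cos θ < 4 = tan ω · h`, and
about half have nonpositive real part, hence distance at least `2` from `2`. So the eigenvalue sum
is at least of order `N`, while `‖v‖^p ≤ 4 + N h^p`. For `N` of order `h^(-p)` the quotient is at
least a constant times `tan^p ω / φ ω`, which tends to infinity (`natCast_le_sectorSum_blockJacobi`,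
`norm_deviation_block_rpow_le`).

Discreteness comes from `mem_discreteSpectrum_perturbation`: the operator is `A + i h P`, with `A`
self-adjoint and `P` the finite-rank projection onto the block, commuting with `A`. Its nonreal
eigenvalues are regular points of `A`, and there the Riesz projection kills the range of `1 - P`. -/

namespace JacobiLT

/-! ### Perturbation by a multiple of a commuting finite-rank projection. -/

section FiniteRankPerturbation

variable {E : Type*} [NormedAddCommGroup E] [NormedSpace ℂ E] {A P : E →L[ℂ] E} {c : ℂ}

theorem resolvent_mul_cancel {T : E →L[ℂ] E} {z : ℂ} (hz : z ∈ resolventSet ℂ T) :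
    (algebraMap ℂ (E →L[ℂ] E) z - T) * resolvent T z = 1 :=
  Ring.mul_inverse_cancel _ hz

theorem resolvent_cancel_mul {T : E →L[ℂ] E} {z : ℂ} (hz : z ∈ resolventSet ℂ T) :
    resolvent T z * (algebraMap ℂ (E →L[ℂ] E) z - T) = 1 :=
  Ring.inverse_mul_cancel _ hz

theorem commute_resolvent (hAP : Commute A P) {z : ℂ} (hz : z ∈ resolventSet ℂ A) :
    Commute (resolvent A z) P := by
  have h : Commute (algebraMap ℂ (E →L[ℂ] E) z - A) P :=
    (Algebra.commute_algebraMap_left z P).sub_left hAP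
  calc resolvent A z * P
      = resolvent A z * (P * ((algebraMap ℂ (E →L[ℂ] E) z - A) * resolvent A z)) := by
        rw [resolvent_mul_cancel hz, mul_one]
    _ = (resolvent A z * (algebraMap ℂ (E →L[ℂ] E) z - A)) * P * resolvent A z := by
        rw [← mul_assoc P, ← h.eq]; simp only [mul_assoc]
    _ = P * resolvent A z := by rw [resolvent_cancel_mul hz, one_mul]

/-- On the complement of the range of the commuting projection `P`, the operators `A` and
`A + c P` have the same resolvent. -/
theorem sub_perturbation_mul_resolvent (hP : P * P = P) (hAP : Commute A P) {z : ℂ}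
    (hz : z ∈ resolventSet ℂ A) :
    (algebraMap ℂ (E →L[ℂ] E) z - (A + c • P)) * (resolvent A z * (1 - P)) = 1 - P := by
  have h1 : (P * resolvent A z) * (1 - P) = 0 := by
    rw [← (commute_resolvent hAP hz).eq, mul_assoc, mul_sub, hP, mul_one, sub_self, mul_zero]
  calc (algebraMap ℂ (E →L[ℂ] E) z - (A + c • P)) * (resolvent A z * (1 - P))
      = (algebraMap ℂ (E →L[ℂ] E) z - A) * resolvent A z * (1 - P)
          - c • ((P * resolvent A z) * (1 - P)) := by
        rw [← sub_sub, sub_mul, smul_mul_assoc]; simp only [mul_assoc]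
    _ = 1 - P := by rw [h1, smul_zero, sub_zero, resolvent_mul_cancel hz, one_mul]

theorem resolvent_perturbation_mul (hP : P * P = P) (hAP : Commute A P) {z : ℂ}
    (hz : z ∈ resolventSet ℂ A) (hz' : z ∈ resolventSet ℂ (A + c • P)) :
    resolvent (A + c • P) z * (1 - P) = resolvent A z * (1 - P) := by
  conv_lhs => rw [← sub_perturbation_mul_resolvent (c := c) hP hAP hz]
  rw [← mul_assoc, resolvent_cancel_mul hz', one_mul]

theorem commute_perturbation (hAP : Commute A P) : Commute (A + c • P) P :=
  hAP.add_left ((Commute.refl P).smul_left c)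

theorem apply_perturbation_mem_range (hAP : Commute A P) (x : E) (hx : x ∈ P.range) :
    (A + c • P) x ∈ P.range := by
  obtain ⟨y, rfl⟩ := hx
  exact ⟨(A + c • P) y, (DFunLike.congr_fun (commute_perturbation (c := c) hAP).eq y).symm⟩

/-- Eigenvectors of `A + c P` to regular points of `A` lie in the range of `P`. -/
theorem mem_range_of_perturbation_apply (hP : P * P = P) (hAP : Commute A P) {z : ℂ}
    (hz : z ∈ resolventSet ℂ A) {u : E} (hu : (A + c • P) u = z • u) : u ∈ P.range := by
  have h1 : (algebraMap ℂ (E →L[ℂ] E) z - A) ((1 - P) u) = 0 := by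
    -- The perturbation `c P` is invisible after multiplication by `1 - P`, so `(1 - P) u` is
    -- annihilated by `z - A`, which is invertible.
    have h2 : (algebraMap ℂ (E →L[ℂ] E) z - A) * (1 - P)
        = (1 - P) * (algebraMap ℂ (E →L[ℂ] E) z - (A + c • P)) := by
      have : (1 - P) * (c • P) = 0 := by
        rw [mul_smul_comm, sub_mul, one_mul, hP, sub_self, smul_zero]
      rw [← sub_sub, mul_sub (1 - P), this, sub_zero]
      exact ((Algebra.commute_algebraMap_left z (1 - P)).sub_left
        ((Commute.one_right A).sub_right hAP)).eq
    have h3 := DFunLike.congr_fun h2 u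
    have h4 : (algebraMap ℂ (E →L[ℂ] E) z - (A + c • P)) u = 0 := by
      rw [sub_apply, hu, ContinuousLinearMap.algebraMap_apply, sub_self]
    rw [mul_apply_eq_comp, mul_apply_eq_comp, h4, map_zero] at h3
    exact h3
  have h5 := DFunLike.congr_fun (resolvent_cancel_mul hz) ((1 - P) u)
  rw [mul_apply_eq_comp, h1, map_zero] at h5
  exact ⟨u, (sub_eq_zero.mp h5.symm).symm⟩

/-- The eigenvectors all lie in the invariant range of `P`, so these are eigenvalues of an
endomorphism of a finite-dimensional space. -/
theorem finite_eigenvalues_perturbation [FiniteDimensional ℂ P.range] (hP : P * P = P)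
    (hAP : Commute A P) :
    {z : ℂ | z ∈ resolventSet ℂ A ∧
      Module.End.HasEigenvalue ((A + c • P : E →L[ℂ] E) : E →ₗ[ℂ] E) z}.Finite := by
  refine (Module.End.finite_hasEigenvalue
    (((A + c • P : E →L[ℂ] E) : E →ₗ[ℂ] E).restrict
      (apply_perturbation_mem_range (c := c) hAP))).subset ?_
  rintro z ⟨hz, hez⟩
  obtain ⟨u, hu⟩ := hez.exists_hasEigenvector
  have hur := mem_range_of_perturbation_apply hP hAP hz hu.apply_eq_smul
  refine Module.End.hasEigenvalue_of_hasEigenvector (x := (⟨u, hur⟩ : P.range)) ⟨?_, ?_⟩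
  · exact Module.End.mem_eigenspace_iff.mpr (Subtype.ext hu.apply_eq_smul)
  · exact fun h => hu.2 (congrArg Subtype.val h)

theorem IsIsolatingRadius.mem_resolventSet {T : E →L[ℂ] E} {l : ℂ} {r : ℝ}
    (h : IsIsolatingRadius T l r) {z : ℂ}
    (hz : z ∈ Metric.closedBall l r) (hne : z ≠ l) : z ∈ resolventSet ℂ T := by
  by_contra hc
  exact hne (h.2.subset ⟨hc, hz⟩)

variable [CompleteSpace E]

/-- Surjectivity is checked on two summands: on the range of `1 - P` the resolvent of `A` gives a
preimage, and on the range of `P` injectivity suffices by finite dimension. -/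
theorem mem_resolventSet_perturbation [FiniteDimensional ℂ P.range] (hP : P * P = P)
    (hAP : Commute A P) {z : ℂ} (hz : z ∈ resolventSet ℂ A)
    (hez : ¬ Module.End.HasEigenvalue ((A + c • P : E →L[ℂ] E) : E →ₗ[ℂ] E) z) :
    z ∈ resolventSet ℂ (A + c • P) := by
  set S : E →L[ℂ] E := algebraMap ℂ (E →L[ℂ] E) z - (A + c • P) with hS
  have hSx : ∀ x, S x = z • x - (A + c • P) x := fun x => rfl
  have hinj : Function.Injective S := by
    refine (injective_iff_map_eq_zero S).mpr fun u hu => ?_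
    by_contra h0
    exact hez (Module.End.hasEigenvalue_of_hasEigenvector (x := u)
      ⟨Module.End.mem_eigenspace_iff.mpr (sub_eq_zero.mp ((hSx u).symm.trans hu)).symm, h0⟩)
  have hmaps : ∀ x ∈ P.range, (S : E →ₗ[ℂ] E) x ∈ P.range := fun x hx =>
    P.range.sub_mem (P.range.smul_mem z hx) (apply_perturbation_mem_range hAP x hx)
  have hsurj : Function.Surjective ((S : E →ₗ[ℂ] E).restrict hmaps) :=
    LinearMap.injective_iff_surjective.mp fun x y hxy =>
      Subtype.ext (hinj (congrArg Subtype.val hxy))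
  refine ContinuousLinearMap.isUnit_iff_bijective.mpr ⟨hinj, fun w => ?_⟩
  obtain ⟨y, hy⟩ := hsurj ⟨P w, w, rfl⟩
  have hy' : S y = P w := congrArg Subtype.val hy
  have h1 : S ((resolvent A z * (1 - P)) w) = w - P w :=
    DFunLike.congr_fun (sub_perturbation_mul_resolvent (c := c) hP hAP hz) w
  exact ⟨(resolvent A z * (1 - P)) w + y, by
    rw [← hS, map_add, h1, hy', sub_add_cancel]⟩

theorem exists_isIsolatingRadius_perturbation [FiniteDimensional ℂ P.range] (hP : P * P = P)
    (hAP : Commute A P) {l : ℂ} (hl : l ∈ resolventSet ℂ A)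
    (hel : Module.End.HasEigenvalue ((A + c • P : E →L[ℂ] E) : E →ₗ[ℂ] E) l) :
    ∃ r : ℝ, IsIsolatingRadius (A + c • P) l r := by
  have hfin := (finite_eigenvalues_perturbation (c := c) hP hAP).sdiff (t := {l})
  have h1 : ∀ᶠ z in 𝓝 l, z ∈ resolventSet ℂ A := (spectrum.isOpen_resolventSet A).mem_nhds hl
  have h2 := hfin.isClosed.isOpen_compl.mem_nhds (x := l) (by simp)
  obtain ⟨r, hr, hsub⟩ := Metric.nhds_basis_closedBall.mem_iff.mp (Filter.inter_mem h1 h2)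
  refine ⟨r, hr, Set.Subset.antisymm ?_ ?_⟩
  · rintro z ⟨hz, hzr⟩
    by_contra hne
    obtain ⟨hzA, hzS⟩ := hsub hzr
    exact hz (mem_resolventSet_perturbation hP hAP hzA fun he => hzS ⟨⟨hzA, he⟩, hne⟩)
  · rintro z (rfl : z = l)
    refine ⟨fun hu => ?_, Metric.mem_closedBall_self hr.le⟩
    obtain ⟨u, hu'⟩ := hel.exists_hasEigenvector
    have h3 := DFunLike.congr_fun (resolvent_cancel_mul hu) u
    have h4 : (A + c • P) u = z • u := hu'.apply_eq_smul
    rw [mul_apply_eq_comp, sub_apply, h4,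
      ContinuousLinearMap.algebraMap_apply, sub_self, map_zero] at h3
    exact hu'.2 h3.symm

theorem _root_.ContinuousLinearMap.circleIntegral_comp_comm {F G : Type*} [NormedAddCommGroup F]
    [NormedSpace ℂ F] [CompleteSpace F] [NormedAddCommGroup G] [NormedSpace ℂ G] [CompleteSpace G]
    (L : F →L[ℂ] G) {f : ℂ → F} {z₀ : ℂ} {r : ℝ} (hf : CircleIntegrable f z₀ r) :
    ∮ z in C(z₀, r), L (f z) = L (∮ z in C(z₀, r), f z) := by
  simp only [circleIntegral, ← map_smul]
  exact L.intervalIntegral_comp_comm hf.out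

theorem differentiableAt_resolvent {T : E →L[ℂ] E} {z : ℂ} (hz : z ∈ resolventSet ℂ T) :
    DifferentiableAt ℂ (resolvent T) z :=
  (spectrum.hasDerivAt_resolvent_const_left hz).differentiableAt

/-! ### Contour integrals of the resolvent. -/

section Riesz

variable {T : E →L[ℂ] E} {l : ℂ} {r : ℝ}

theorem IsIsolatingRadius.circleIntegrable (h : IsIsolatingRadius T l r) :
    CircleIntegrable (resolvent T) l r := by
  refine ContinuousOn.circleIntegrable h.1.le fun z hz => ?_
  exact (differentiableAt_resolvent (h.mem_resolventSet (Metric.sphere_subset_closedBall hz)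
    (Metric.ne_of_mem_sphere hz h.1.ne'))).continuousAt.continuousWithinAt

/-- On an eigenvector the resolvent acts as `(z - l)⁻¹`; hence the Riesz projection fixes
eigenvectors. -/
theorem IsIsolatingRadius.circleIntegral_resolvent_apply (h : IsIsolatingRadius T l r) {u : E}
    (hu : T u = l • u) :
    (∮ z in C(l, r), resolvent T z) u = (2 * Real.pi * Complex.I : ℂ) • u := by
  have h1 := ContinuousLinearMap.circleIntegral_comp_comm
    (ContinuousLinearMap.apply ℂ E u) h.circleIntegrable
  rw [ContinuousLinearMap.apply_apply] at h1
  rw [← h1, ← circleIntegral.integral_sub_center_inv l h.1.ne',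
    ← circleIntegral.integral_smul_const]
  refine circleIntegral.integral_congr h.1.le fun z hz => ?_
  have hne := Metric.ne_of_mem_sphere hz h.1.ne'
  have h2 := DFunLike.congr_fun (resolvent_cancel_mul
    (h.mem_resolventSet (Metric.sphere_subset_closedBall hz) hne)) u
  rw [mul_apply_eq_comp, sub_apply, hu,
    ContinuousLinearMap.algebraMap_apply, ← sub_smul, map_smul] at h2
  exact (eq_inv_smul_iff₀ (sub_ne_zero.mpr hne)).mpr h2

/-- Off `l` the integrand agrees with `resolvent A z * (1 - P)` near `l`, so the singularity is
removable and Cauchy's theorem applies. -/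
theorem IsIsolatingRadius.circleIntegral_resolvent_perturbation_mul
    (h : IsIsolatingRadius (A + c • P) l r) (hP : P * P = P) (hAP : Commute A P)
    (hl : l ∈ resolventSet ℂ A) :
    (∮ z in C(l, r), resolvent (A + c • P) z) * (1 - P) = 0 := by
  classical
  have h1 := ContinuousLinearMap.circleIntegral_comp_comm
    ((ContinuousLinearMap.mul ℂ (E →L[ℂ] E)).flip (1 - P)) h.circleIntegrable
  rw [ContinuousLinearMap.flip_apply, ContinuousLinearMap.mul_apply'] at h1
  rw [← h1]
  -- At `l` itself `resolvent (A + c • P)` has only the default value of `Ring.inverse`, so the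
  -- value there is replaced by the holomorphic one.
  let f : ℂ → E →L[ℂ] E :=
    Function.update (fun z => resolvent (A + c • P) z * (1 - P)) l (resolvent A l * (1 - P))
  have hfl : f =ᶠ[𝓝 l] fun z => resolvent A z * (1 - P) := by
    filter_upwards [(spectrum.isOpen_resolventSet A).mem_nhds hl,
      Metric.closedBall_mem_nhds l h.1] with z hzA hzr
    rcases eq_or_ne z l with rfl | hne
    · simp [f]
    · simp only [f, Function.update_of_ne hne]
      exact resolvent_perturbation_mul hP hAP hzA (h.mem_resolventSet hzr hne)
  have hfz : ∀ z ≠ l, f =ᶠ[𝓝 z] fun z => resolvent (A + c • P) z * (1 - P) := fun z hne => by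
    filter_upwards [isOpen_ne.mem_nhds hne] with w hw
    exact Function.update_of_ne hw _ _
  have hd : ∀ z ∈ Metric.closedBall l r, DifferentiableAt ℂ f z := fun z hz => by
    rcases eq_or_ne z l with rfl | hne
    · exact ((differentiableAt_resolvent hl).mul_const _).congr_of_eventuallyEq hfl
    · exact ((differentiableAt_resolvent (h.mem_resolventSet hz hne)).mul_const
        _).congr_of_eventuallyEq (hfz z hne)
  rw [← Complex.circleIntegral_eq_zero_of_differentiable_on_off_countable h.1.le
    Set.countable_empty (fun z hz => (hd z hz).continuousAt.continuousWithinAt)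
    (fun z hz => hd z (Metric.ball_subset_closedBall hz.1))]
  refine circleIntegral.integral_congr h.1.le fun z hz => ?_
  exact (hfz z (Metric.ne_of_mem_sphere hz h.1.ne')).self_of_nhds.symm

end Riesz

/-- Eigenvalues of `A + c P` at regular points of `A` are discrete eigenvalues if `P` is a
finite-rank projection commuting with `A`. -/
theorem mem_discreteSpectrum_perturbation [FiniteDimensional ℂ P.range] (hP : P * P = P)
    (hAP : Commute A P) {l : ℂ} (hl : l ∈ resolventSet ℂ A)
    (hel : Module.End.HasEigenvalue ((A + c • P : E →L[ℂ] E) : E →ₗ[ℂ] E) l) :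
    l ∈ discreteSpectrum (A + c • P) ∧ 1 ≤ algMultiplicity (A + c • P) l := by
  have hex := exists_isIsolatingRadius_perturbation hP hAP hl hel
  set R := rieszProjection (A + c • P) l with hR
  have hRdef : R = (2 * Real.pi * Complex.I : ℂ)⁻¹ •
      ∮ z in C(l, hex.choose), resolvent (A + c • P) z := by
    rw [hR, rieszProjection, dif_pos hex]
  have hRP : R * (1 - P) = 0 := by
    rw [hRdef, smul_mul_assoc,
      hex.choose_spec.circleIntegral_resolvent_perturbation_mul hP hAP hl, smul_zero]
  obtain ⟨u, hu⟩ := hel.exists_hasEigenvector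
  have hRu : R u = u := by
    rw [hRdef, smul_apply,
      hex.choose_spec.circleIntegral_resolvent_apply hu.apply_eq_smul]
    exact inv_smul_smul₀ Complex.two_pi_I_ne_zero u
  -- Since `R = R P`, the range of `R` is the image of the finite-dimensional range of `P`.
  have hle : R.range ≤ P.range.map (R : E →ₗ[ℂ] E) := by
    rintro _ ⟨x, rfl⟩
    have h1 : R (x - P x) = 0 := DFunLike.congr_fun hRP x
    rw [map_sub, sub_eq_zero] at h1
    exact ⟨P x, ⟨x, rfl⟩, h1.symm⟩
  have hfd : FiniteDimensional ℂ R.range := Submodule.finiteDimensional_of_le hle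
  refine ⟨⟨hel, hex, hfd⟩, ?_⟩
  have : Nontrivial R.range :=
    ⟨⟨⟨u, u, hRu⟩, 0, fun h => hu.2 (congrArg Subtype.val h)⟩⟩
  exact Module.finrank_pos (R := ℂ) (M := R.range)

end FiniteRankPerturbation

end JacobiLT

/-! ### The decoupled Jacobi operator and its block eigenvectors. -/

noncomputable section

namespace JacobiLT

/-- The indicator function of a set of integers as a bounded sequence. -/
def indicatorSeq (S : Set ℤ) : ℓ^∞(ℤ, ℂ) :=
  ⟨S.indicator 1, memℓp_infty ⟨1, by
    rintro _ ⟨n, rfl⟩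
    by_cases hn : n ∈ S <;> simp [hn]⟩⟩

theorem indicatorSeq_apply (S : Set ℤ) (n : ℤ) : indicatorSeq S n = S.indicator 1 n := rfl

theorem mulOp_apply (a : ℓ^∞(ℤ, ℂ)) (u : ℓ²(ℤ, ℂ)) (n : ℤ) : mulOp a u n = a n * u n := rfl

theorem jacobi_eq_add_smul (a b c : ℓ^∞(ℤ, ℂ)) (t : ℂ) :
    jacobi a (t • b) c = jacobi a 0 c + t • mulOp b := by
  refine ContinuousLinearMap.ext fun u => lp.ext (funext fun n => ?_)
  change _ = jacobi a 0 c u n + t * mulOp b u n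
  rw [jacobi_apply, jacobi_apply, mulOp_apply]
  change _ + t * b n * _ + _ = _ + 0 * _ + _ + _
  ring

theorem inner_shift_left (k : ℤ) (u w : ℓ²(ℤ, ℂ)) :
    inner ℂ (shift k u) w = inner ℂ u (shift (-k) w) := by
  rw [lp.inner_eq_tsum, lp.inner_eq_tsum,
    ← (Equiv.addRight k).tsum_eq fun n => inner ℂ (u n) (shift (-k) w n)]
  refine tsum_congr fun n => ?_
  change inner ℂ (u (n + k)) (w n) = inner ℂ (u (n + k)) (w (n + k + -k))
  rw [add_neg_cancel_right]

theorem inner_mulOp_left {a : ℓ^∞(ℤ, ℂ)} (ha : ∀ n, star (a n) = a n) (u w : ℓ²(ℤ, ℂ)) :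
    inner ℂ (mulOp a u) w = inner ℂ u (mulOp a w) := by
  rw [lp.inner_eq_tsum, lp.inner_eq_tsum]
  refine tsum_congr fun n => ?_
  have h : starRingEnd ℂ (a n) = a n := ha n
  rw [mulOp_apply, mulOp_apply, RCLike.inner_apply, RCLike.inner_apply, map_mul, h]
  ring

theorem isSelfAdjoint_jacobi {a : ℓ^∞(ℤ, ℂ)} (ha : ∀ n, star (a n) = a n) :
    IsSelfAdjoint (jacobi a 0 a) := by
  refine ((ContinuousLinearMap.eq_adjoint_iff _ _).mpr fun u w => ?_).symm
  have h0 : mulOp 0 = 0 := map_zero _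
  have hJ : ∀ x, jacobi a 0 a x = shift (-1) (mulOp a x) + mulOp a (shift 1 x) := fun x => by
    rw [jacobi, h0, add_zero]; rfl
  rw [hJ, hJ, inner_add_left, inner_add_right, inner_shift_left, inner_mulOp_left ha,
    inner_mulOp_left ha, inner_shift_left, neg_neg, add_comm]

theorem mulOp_indicatorSeq_mul_self (S : Set ℤ) :
    mulOp (indicatorSeq S) * mulOp (indicatorSeq S) = mulOp (indicatorSeq S) := by
  refine ContinuousLinearMap.ext fun u => lp.ext (funext fun n => ?_)
  rw [mul_apply_eq_comp, mulOp_apply, mulOp_apply, indicatorSeq_apply]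
  by_cases hn : n ∈ S <;> simp [hn]

theorem finiteDimensional_range_mulOp_indicatorSeq {S : Set ℤ} (hS : S.Finite) :
    FiniteDimensional ℂ (mulOp (indicatorSeq S)).range := by
  have := hS.to_subtype
  let r : (mulOp (indicatorSeq S)).range →ₗ[ℂ] (S → ℂ) :=
    { toFun := fun u n => (u : ℓ²(ℤ, ℂ)) n
      map_add' := fun _ _ => rfl
      map_smul' := fun _ _ => rfl }
  refine FiniteDimensional.of_injective r ((injective_iff_map_eq_zero r).mpr ?_)
  rintro ⟨_, u, rfl⟩ hu
  refine Subtype.ext (lp.ext (funext fun n => ?_))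
  by_cases hn : n ∈ S
  · exact congrFun hu ⟨n, hn⟩
  · change mulOp (indicatorSeq S) u n = 0
    rw [mulOp_apply, indicatorSeq_apply, Set.indicator_of_notMem hn, zero_mul]

/-- Off-diagonal entries that are `1` except at `0` and `N`, where they vanish. -/
def cutSeq (N : ℤ) : ℓ^∞(ℤ, ℂ) := indicatorSeq {0, N}ᶜ

theorem cutSeq_of_ne {N n : ℤ} (h0 : n ≠ 0) (hN : n ≠ N) : cutSeq N n = 1 :=
  Set.indicator_of_mem (by simp [h0, hN]) _

theorem cutSeq_zero (N : ℤ) : cutSeq N 0 = 0 :=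
  Set.indicator_of_notMem (by simp) _

theorem cutSeq_self (N : ℤ) : cutSeq N N = 0 :=
  Set.indicator_of_notMem (by simp) _

/-- The indicator sequence of the block `{1, …, N}`. -/
def blockSeq (N : ℤ) : ℓ^∞(ℤ, ℂ) := indicatorSeq (Set.Icc 1 N)

theorem blockSeq_of_mem {N n : ℤ} (hn : n ∈ Set.Icc 1 N) : blockSeq N n = 1 :=
  Set.indicator_of_mem hn _

theorem blockSeq_of_notMem {N n : ℤ} (hn : n ∉ Set.Icc 1 N) : blockSeq N n = 0 :=
  Set.indicator_of_notMem hn _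

/-- The block indicator can jump only across the bonds `0` and `N`, exactly where the off-diagonal
entries vanish. This makes the block projection commute with the operator. -/
theorem cutSeq_mul_blockSeq (N n : ℤ) :
    cutSeq N n * blockSeq N n = cutSeq N n * blockSeq N (n + 1) := by
  by_cases h0 : n = 0
  · rw [h0, cutSeq_zero, zero_mul, zero_mul]
  by_cases hN : n = N
  · rw [hN, cutSeq_self, zero_mul, zero_mul]
  congr 1
  by_cases hn : n ∈ Set.Icc 1 N
  · rw [blockSeq_of_mem hn, blockSeq_of_mem]
    rw [Set.mem_Icc] at hn ⊢
    omega
  · rw [blockSeq_of_notMem hn, blockSeq_of_notMem]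
    rw [Set.mem_Icc] at hn ⊢
    omega

theorem commute_jacobi_cutSeq (N : ℤ) :
    Commute (jacobi (cutSeq N) 0 (cutSeq N)) (mulOp (blockSeq N)) := by
  refine ContinuousLinearMap.ext fun u => lp.ext (funext fun n => ?_)
  rw [mul_apply_eq_comp, mul_apply_eq_comp, jacobi_apply, mulOp_apply, mulOp_apply, mulOp_apply,
    mulOp_apply, jacobi_apply]
  have h1 := cutSeq_mul_blockSeq N n
  have h2 := cutSeq_mul_blockSeq N (n - 1)
  rw [sub_add_cancel] at h2
  change _ + 0 * _ + _ = _ * (_ + 0 * _ + _)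
  linear_combination u (n - 1) * h2 - u (n + 1) * h1

/-- The Jacobi operator that splits into the finite block `{1, …, N}`, shifted by `i h`, and two
free half-lines. -/
def blockJacobi (N : ℤ) (h : ℝ) : ℓ²(ℤ, ℂ) →L[ℂ] ℓ²(ℤ, ℂ) :=
  jacobi (cutSeq N) ((Complex.I * h) • blockSeq N) (cutSeq N)

/-- The sequence `sin (n θ)` restricted to the block `{1, …, N}`. -/
def sineVector (N : ℤ) (θ : ℝ) : ℓ²(ℤ, ℂ) :=
  ⟨(Set.Icc 1 N).indicator fun n => ((Real.sin (n * θ) : ℝ) : ℂ),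
    (memℓp_zero ((Set.finite_Icc 1 N).subset fun n hn => by
      by_contra h
      exact hn (Set.indicator_of_notMem h _))).of_exponent_ge zero_le⟩

theorem sineVector_of_mem {N n : ℤ} {θ : ℝ} (hn : n ∈ Set.Icc 1 N) :
    sineVector N θ n = ((Real.sin (n * θ) : ℝ) : ℂ) :=
  Set.indicator_of_mem hn fun n : ℤ => ((Real.sin (n * θ) : ℝ) : ℂ)

theorem sineVector_of_notMem {N n : ℤ} {θ : ℝ} (hn : n ∉ Set.Icc 1 N) :
    sineVector N θ n = 0 :=
  Set.indicator_of_notMem hn fun n : ℤ => ((Real.sin (n * θ) : ℝ) : ℂ)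

/-- Inside the block this is the three-term recurrence for `sin (n θ)`. The cut bonds are harmless
at the ends because the sine vanishes at `0` and, by `hθ`, at `N + 1`. -/
theorem blockJacobi_sineVector {N : ℤ} {θ : ℝ} (h : ℝ)
    (hθ : Real.sin ((N + 1) * θ) = 0) :
    blockJacobi N h (sineVector N θ) =
      ((2 * Real.cos θ : ℝ) + Complex.I * h : ℂ) • sineVector N θ := by
  refine lp.ext (funext fun n => ?_)
  rw [blockJacobi, jacobi_apply]
  change _ + (Complex.I * h) * blockSeq N n * _ + _ =
    ((2 * Real.cos θ : ℝ) + Complex.I * h : ℂ) * sineVector N θ n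
  by_cases hn : n ∈ Set.Icc 1 N
  · have h1 : cutSeq N (n - 1) * sineVector N θ (n - 1) = (Real.sin ((n - 1) * θ) : ℝ) := by
      rw [Set.mem_Icc] at hn
      rcases eq_or_ne n 1 with rfl | h1
      · rw [sub_self, cutSeq_zero]; simp
      · rw [cutSeq_of_ne (by omega) (by omega), one_mul,
          sineVector_of_mem (Set.mem_Icc.mpr (by omega))]
        push_cast; rfl
    have h2 : cutSeq N n * sineVector N θ (n + 1) = (Real.sin ((n + 1) * θ) : ℝ) := by
      rw [Set.mem_Icc] at hn
      rcases eq_or_ne n N with rfl | h2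
      · rw [cutSeq_self, hθ]; simp
      · rw [cutSeq_of_ne (by omega) h2, one_mul,
          sineVector_of_mem (Set.mem_Icc.mpr (by omega))]
        push_cast; rfl
    have h3 : Real.sin ((n - 1) * θ) + Real.sin ((n + 1) * θ)
        = 2 * Real.cos θ * Real.sin (n * θ) := by
      rw [sub_mul, add_mul, one_mul, Real.sin_sub, Real.sin_add]; ring
    rw [h1, h2, blockSeq_of_mem hn, sineVector_of_mem hn, add_right_comm, ← Complex.ofReal_add, h3]
    push_cast; ring
  · have h1 : cutSeq N (n - 1) * sineVector N θ (n - 1) = 0 := by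
      rcases eq_or_ne (n - 1) N with h1 | h1
      · rw [h1, cutSeq_self, zero_mul]
      · rw [sineVector_of_notMem, mul_zero]
        rw [Set.mem_Icc] at hn ⊢
        omega
    have h2 : cutSeq N n * sineVector N θ (n + 1) = 0 := by
      rcases eq_or_ne n 0 with rfl | h2
      · rw [cutSeq_zero, zero_mul]
      · rw [sineVector_of_notMem, mul_zero]
        rw [Set.mem_Icc] at hn ⊢
        omega
    rw [h1, h2, sineVector_of_notMem hn]
    simp

theorem sineVector_ne_zero {N : ℤ} (hN : 1 ≤ N) {θ : ℝ} (hθ : θ ∈ Set.Ioo 0 Real.pi) :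
    sineVector N θ ≠ 0 := fun h0 => by
  have h1 : sineVector N θ 1 = 0 := by rw [h0]; rfl
  rw [sineVector_of_mem ⟨le_rfl, hN⟩, Int.cast_one, one_mul, Complex.ofReal_eq_zero] at h1
  exact (Real.sin_pos_of_mem_Ioo hθ).ne' h1

/-- The unperturbed operator is self-adjoint, so an eigenvalue with imaginary part `h > 0` is a
regular point of it. -/
theorem mem_discreteSpectrum_blockJacobi {N : ℤ} (hN : 1 ≤ N) {θ h : ℝ} (hh : 0 < h)
    (hθ : θ ∈ Set.Ioo 0 Real.pi) (hsin : Real.sin ((N + 1) * θ) = 0) :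
    ((2 * Real.cos θ : ℝ) + Complex.I * h : ℂ) ∈ discreteSpectrum (blockJacobi N h) ∧
      1 ≤ algMultiplicity (blockJacobi N h) ((2 * Real.cos θ : ℝ) + Complex.I * h : ℂ) := by
  have hJ : blockJacobi N h = jacobi (cutSeq N) 0 (cutSeq N) +
      (Complex.I * h : ℂ) • mulOp (blockSeq N) := jacobi_eq_add_smul _ _ _ _
  have hsa : IsSelfAdjoint (jacobi (cutSeq N) 0 (cutSeq N)) := isSelfAdjoint_jacobi fun n => by
    rw [cutSeq, indicatorSeq_apply]
    by_cases hn : n ∈ ({0, N}ᶜ : Set ℤ)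
    · rw [Set.indicator_of_mem hn]; exact star_one ℂ
    · rw [Set.indicator_of_notMem hn]; exact star_zero ℂ
  have hfd : FiniteDimensional ℂ (mulOp (blockSeq N)).range :=
    finiteDimensional_range_mulOp_indicatorSeq (Set.finite_Icc 1 N)
  rw [hJ]
  refine mem_discreteSpectrum_perturbation (P := mulOp (blockSeq N)) (mulOp_indicatorSeq_mul_self _)
    (commute_jacobi_cutSeq N) ?_ ?_
  · by_contra hc
    have him := hsa.im_eq_zero_of_mem_spectrum hc
    simp at him
    exact hh.ne' him
  · rw [← hJ]
    exact Module.End.hasEigenvalue_of_hasEigenvector ⟨Module.End.mem_eigenspace_iff.mpr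
      (blockJacobi_sineVector h hsin), sineVector_ne_zero hN hθ⟩

end JacobiLT
end

/-! ### Size of the perturbation, eigenvalue count and the lower bound. -/

noncomputable section

namespace JacobiLT

theorem deviation_nonneg (a b c : ℓ^∞(ℤ, ℂ)) (n : ℤ) : 0 ≤ deviation a b c n :=
  le_max_of_le_left (norm_nonneg _)

theorem norm_cutSeq_sub_one_le (N n : ℤ) : ‖cutSeq N n - 1‖ ≤ 1 := by
  by_cases h0 : n = 0
  · simp [h0, cutSeq_zero]
  by_cases hN : n = N
  · simp [hN, cutSeq_self]
  · simp [cutSeq_of_ne h0 hN]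

theorem norm_smul_blockSeq_le (N n : ℤ) {h : ℝ} (hh : 0 < h) :
    ‖((Complex.I * h : ℂ) • blockSeq N) n‖ ≤ h := by
  change ‖(Complex.I * h : ℂ) * blockSeq N n‖ ≤ h
  by_cases hn : n ∈ Set.Icc 1 N
  · simp [blockSeq_of_mem hn, abs_of_pos hh]
  · simp [blockSeq_of_notMem hn, hh.le]

section Deviation

variable {N : ℤ} {h : ℝ}

theorem deviation_block_le_one (hh : 0 < h) (h1 : h ≤ 1) (n : ℤ) :
    deviation (cutSeq N) ((Complex.I * h : ℂ) • blockSeq N) (cutSeq N) n ≤ 1 :=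
  max_le (norm_cutSeq_sub_one_le _ _) <| max_le (norm_cutSeq_sub_one_le _ _) <|
    max_le ((norm_smul_blockSeq_le N n hh).trans h1) <|
    max_le (norm_cutSeq_sub_one_le _ _) (norm_cutSeq_sub_one_le _ _)

/-- The excluded sites are those with `n` or `n - 1` on a cut bond. -/
theorem deviation_block_eq (n : ℤ) (hn : n ∉ ({0, 1, N, N + 1} : Finset ℤ)) :
    deviation (cutSeq N) ((Complex.I * h : ℂ) • blockSeq N) (cutSeq N) n =
      ‖((Complex.I * h : ℂ) • blockSeq N) n‖ := by
  simp only [Finset.mem_insert, Finset.mem_singleton, not_or] at hn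
  rw [deviation, cutSeq_of_ne (n := n) hn.1 hn.2.2.1,
    cutSeq_of_ne (n := n - 1) (by omega) (by omega), sub_self, norm_zero,
    max_self, max_eq_left (norm_nonneg _),
    max_eq_right (norm_nonneg _), max_eq_right (norm_nonneg _)]

theorem deviation_block_eq_zero (n : ℤ)
    (hn : n ∉ ({0, 1, N, N + 1} ∪ Finset.Icc 1 N : Finset ℤ)) :
    deviation (cutSeq N) ((Complex.I * h : ℂ) • blockSeq N) (cutSeq N) n = 0 := by
  rw [Finset.mem_union, not_or, Finset.mem_Icc] at hn
  rw [deviation_block_eq n hn.1]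
  change ‖(Complex.I * h : ℂ) * blockSeq N n‖ = 0
  rw [blockSeq_of_notMem hn.2, mul_zero, norm_zero]

theorem memℓp_deviation_block (q : ℝ≥0∞) :
    Memℓp (deviation (cutSeq N) ((Complex.I * h : ℂ) • blockSeq N) (cutSeq N)) q :=
  (memℓp_zero ((Finset.finite_toSet ({0, 1, N, N + 1} ∪ Finset.Icc 1 N)).subset fun n hn => by
    by_contra hc
    exact hn (deviation_block_eq_zero n hc))).of_exponent_ge zero_le

theorem deviation_block_ne_zero :
    deviation (cutSeq N) ((Complex.I * h : ℂ) • blockSeq N) (cutSeq N) ≠ 0 := fun h0 => by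
  have h1 : (1 : ℝ) ≤ deviation (cutSeq N) ((Complex.I * h : ℂ) • blockSeq N) (cutSeq N) 0 :=
    le_max_of_le_right (le_max_of_le_left (by rw [cutSeq_zero]; simp))
  rw [h0] at h1
  exact absurd h1 (by simp)

/-- At most four sites touch a cut and cost at most `1` each; every other site of the block costs at
most `h ^ p`. -/
theorem norm_deviation_block_rpow_le {p : ℝ} (hp : 0 < p) (hN : 0 ≤ N) (hh : 0 < h) (h1 : h ≤ 1)
    (hv : Memℓp (deviation (cutSeq N) ((Complex.I * h : ℂ) • blockSeq N) (cutSeq N))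
      (ENNReal.ofReal p)) :
    ‖(⟨_, hv⟩ : ℓ^(ENNReal.ofReal p)(ℤ, ℝ))‖ ^ p ≤ 4 + N * h ^ p := by
  have hp' : (ENNReal.ofReal p).toReal = p := ENNReal.toReal_ofReal hp.le
  have hsum := lp.norm_rpow_eq_tsum (p := ENNReal.ofReal p) (by rwa [hp'])
    (⟨_, hv⟩ : ℓ^(ENNReal.ofReal p)(ℤ, ℝ))
  rw [hp'] at hsum
  rw [hsum]
  set v := deviation (cutSeq N) ((Complex.I * h : ℂ) • blockSeq N) (cutSeq N) with hvdef
  have hnorm : ∀ n, ‖v n‖ = v n := fun n => Real.norm_of_nonneg (deviation_nonneg _ _ _ n)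
  calc ∑' n, ‖v n‖ ^ p
      = ∑ n ∈ {0, 1, N, N + 1} ∪ (Finset.Icc 1 N \ {0, 1, N, N + 1}), ‖v n‖ ^ p := by
        refine tsum_eq_sum fun n hn => ?_
        rw [Finset.union_sdiff_self_eq_union] at hn
        rw [hvdef, deviation_block_eq_zero n hn, norm_zero, Real.zero_rpow hp.ne']
    _ = ∑ n ∈ {0, 1, N, N + 1}, ‖v n‖ ^ p +
        ∑ n ∈ Finset.Icc 1 N \ {0, 1, N, N + 1}, ‖v n‖ ^ p :=
        Finset.sum_union Finset.disjoint_sdiff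
    _ ≤ ({0, 1, N, N + 1} : Finset ℤ).card • (1 : ℝ) +
        (Finset.Icc 1 N \ {0, 1, N, N + 1}).card • h ^ p := by
        refine add_le_add (Finset.sum_le_card_nsmul _ _ _ fun n _ => ?_)
          (Finset.sum_le_card_nsmul _ _ _ fun n hn => ?_)
        · rw [hnorm]
          exact Real.rpow_le_one (deviation_nonneg _ _ _ n) (deviation_block_le_one hh h1 n) hp.le
        · refine Real.rpow_le_rpow (norm_nonneg _) ?_ hp.le
          rw [hnorm, hvdef, deviation_block_eq n (Finset.mem_sdiff.mp hn).2]
          exact norm_smul_blockSeq_le N n hh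
    _ ≤ 4 + N * h ^ p := by
        rw [nsmul_eq_mul, nsmul_eq_mul, mul_one]
        refine add_le_add (by exact_mod_cast Finset.card_le_four) ?_
        refine mul_le_mul_of_nonneg_right ?_ (Real.rpow_nonneg hh.le p)
        have h2 : (Finset.Icc 1 N \ {0, 1, N, N + 1}).card ≤ (Finset.Icc 1 N).card :=
          Finset.card_le_card Finset.sdiff_subset
        rw [Int.card_Icc] at h2
        exact_mod_cast (by omega : ((Finset.Icc 1 N \ {0, 1, N, N + 1}).card : ℤ) ≤ N)

end Deviation

theorem natCast_le_sectorSum_blockJacobi {p ω : ℝ} (hp : 1 / 2 ≤ p) {M : ℕ} (hM : 1 ≤ M) {h : ℝ}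
    (hh : 0 < h) (hω : Real.tan ω * h = 4) :
    (M : ℝ≥0∞) ≤ sectorSum p ω (blockJacobi (2 * M - 1) h) := by
  -- With `N + 1 = 2M`, these are the angles `jπ/(N+1)` in `[π/2, π)`, where the cosine is
  -- nonpositive.
  let θ : Fin M → ℝ := fun k => (M + k : ℝ) * Real.pi / (2 * M)
  have hM0 : (0 : ℝ) < M := by exact_mod_cast hM
  have hθ1 : ∀ k, Real.pi / 2 ≤ θ k := fun k => by
    rw [le_div_iff₀ (by positivity)]
    have : (0 : ℝ) ≤ (k : ℝ) * Real.pi := by positivity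
    linarith
  have hθ2 : ∀ k, θ k < Real.pi := fun k => by
    rw [div_lt_iff₀ (by positivity)]
    have : (k : ℝ) < M := by exact_mod_cast k.2
    nlinarith [Real.pi_pos]
  have hθ : ∀ k, θ k ∈ Set.Ioo 0 Real.pi := fun k =>
    ⟨(half_pos Real.pi_pos).trans_le (hθ1 k), hθ2 k⟩
  have hcos : ∀ k, Real.cos (θ k) ≤ 0 := fun k =>
    Real.cos_nonpos_of_pi_div_two_le_of_le (hθ1 k) (by linarith [hθ2 k, Real.pi_pos])
  have hcos' : ∀ k, -1 < Real.cos (θ k) := fun k => by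
    rw [← Real.cos_pi]
    exact Real.cos_lt_cos_of_nonneg_of_le_pi (hθ k).1.le le_rfl (hθ2 k)
  have hsin : ∀ k, Real.sin ((((2 * M - 1 : ℤ) : ℝ) + 1) * θ k) = 0 := fun k => by
    have : (((2 * M - 1 : ℤ) : ℝ) + 1) * θ k = ((M + k : ℕ) : ℝ) * Real.pi := by
      push_cast
      simp only [θ]
      field_simp
      ring
    rw [this, Real.sin_nat_mul_pi]
  let l : Fin M → ℂ := fun k => (2 * Real.cos (θ k) : ℝ) + Complex.I * h
  have hre : ∀ k, (l k).re = 2 * Real.cos (θ k) := fun k => by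
    simp only [l, Complex.add_re, Complex.ofReal_re, Complex.I_mul_re, Complex.ofReal_im, neg_zero,
      add_zero]
  have him : ∀ k, (l k).im = h := fun k => by simp [l]
  have hdisc := fun k => mem_discreteSpectrum_blockJacobi (by omega) hh (hθ k) (hsin k)
  let i : Fin M → {l : ℂ // l ∈ discreteSpectrum (blockJacobi (2 * M - 1) h) ∧
      2 - l.re < Real.tan ω * |l.im|} := fun k => ⟨l k, (hdisc k).1, by
    rw [hre, him, abs_of_pos hh, hω]
    linarith [hcos' k]⟩
  have hi : Function.Injective i := fun j k hjk => by
    have h1 : (l j).re = (l k).re := congrArg (fun z => (Subtype.val z).re) hjk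
    rw [hre, hre] at h1
    have h2 := Real.injOn_cos (Set.Ioo_subset_Icc_self (hθ j)) (Set.Ioo_subset_Icc_self (hθ k))
      (mul_left_cancel₀ two_ne_zero h1)
    have h3 : (M + j : ℝ) = M + k :=
      mul_right_cancel₀ Real.pi_pos.ne' ((div_left_inj' (by positivity)).mp h2)
    exact Fin.ext (by exact_mod_cast add_left_cancel h3)
  refine le_trans ?_ (ENNReal.tsum_comp_le_tsum_of_injective hi _)
  calc (M : ℝ≥0∞) = ∑' _ : Fin M, (1 : ℝ≥0∞) := by simp [tsum_fintype]
    _ ≤ _ := ENNReal.tsum_le_tsum fun k => ?_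
  have h1 : (1 : ℝ≥0∞) ≤ algMultiplicity (blockJacobi (2 * M - 1) h) (l k) := by
    exact_mod_cast (hdisc k).2
  have h2 : (1 : ℝ) ≤ ‖l k - 2‖ := by
    have h3 := Complex.abs_re_le_norm (l k - 2)
    rw [Complex.sub_re, hre, Complex.re_ofNat] at h3
    linarith [neg_le_abs (2 * Real.cos (θ k) - 2), hcos k]
  calc (1 : ℝ≥0∞) = 1 * 1 := (mul_one 1).symm
    _ ≤ _ := mul_le_mul' h1 (ENNReal.one_le_ofReal.mpr (Real.one_le_rpow h2 (by linarith)))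

/-- The quotient in the Lieb–Thirring inequality is at least of order `tan ^ p ω`. -/
theorem ofReal_tan_rpow_div_le_iSup {p ω s : ℝ} (hp : 1 ≤ p) (hω : 4 ≤ Real.tan ω) (hs : 0 < s) :
    ENNReal.ofReal (Real.tan ω ^ p / s / (6 * 4 ^ p)) ≤
      ⨆ (a : ℓ^∞(ℤ, ℂ)) (b : ℓ^∞(ℤ, ℂ)) (c : ℓ^∞(ℤ, ℂ))
        (hv : Memℓp (deviation a b c) (ENNReal.ofReal p)) (_ : deviation a b c ≠ 0),
        (ENNReal.ofReal (s * ‖(⟨deviation a b c, hv⟩ : ℓ^(ENNReal.ofReal p)(ℤ, ℝ))‖ ^ p))⁻¹ *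
          sectorSum p ω (jacobi a b c) := by
  have ht : 0 < Real.tan ω := by linarith
  set h : ℝ := 4 / Real.tan ω with hdef
  have hh : 0 < h := by positivity
  have h1 : h ≤ 1 := (div_le_one ht).mpr hω
  have hhp : 0 < h ^ p := Real.rpow_pos_of_pos hh p
  -- This size gives `1 ≤ M h^p`, so the fixed cost `4` of the cuts is absorbed: `4 + (2M - 1) h^p ≤
  -- 6 M h^p`.
  set M : ℕ := ⌈(h ^ p)⁻¹⌉₊ with hMdef
  have hM : 1 ≤ M := Nat.one_le_ceil_iff.mpr (inv_pos.mpr hhp)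
  have hM0 : (0 : ℝ) < M := by exact_mod_cast hM
  have hMh : 1 ≤ M * h ^ p := (inv_le_iff_one_le_mul₀ hhp).mp (Nat.le_ceil _)
  let N : ℤ := 2 * M - 1
  have hv := memℓp_deviation_block (N := N) (h := h) (ENNReal.ofReal p)
  have hnorm : ‖(⟨_, hv⟩ : ℓ^(ENNReal.ofReal p)(ℤ, ℝ))‖ ^ p ≤ 6 * (M * h ^ p) := by
    refine (norm_deviation_block_rpow_le (by linarith) (by omega) hh h1 hv).trans ?_
    simp only [N]
    push_cast
    linarith
  refine le_iSup_of_le (cutSeq N) <| le_iSup_of_le ((Complex.I * h : ℂ) • blockSeq N) <|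
    le_iSup_of_le (cutSeq N) <| le_iSup_of_le hv <| le_iSup_of_le deviation_block_ne_zero ?_
  refine le_trans ?_ (mul_le_mul' (ENNReal.inv_le_inv.mpr (ENNReal.ofReal_le_ofReal
    (mul_le_mul_of_nonneg_left hnorm hs.le)))
    (natCast_le_sectorSum_blockJacobi (by linarith) hM hh (mul_div_cancel₀ 4 ht.ne')))
  rw [← ENNReal.ofReal_inv_of_pos (by positivity), ← ENNReal.ofReal_natCast M,
    ← ENNReal.ofReal_mul (by positivity)]
  refine ENNReal.ofReal_le_ofReal (le_of_eq ?_)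
  rw [hdef, Real.div_rpow (by norm_num) ht.le]
  have : 0 < Real.tan ω ^ p := Real.rpow_pos_of_pos ht p
  field_simp

end JacobiLT

end
theorem mainTheorem11 (p : ℝ) (hp : 1 ≤ p) (φ : ℝ → ℝ)
    (hφ_cont : ContinuousOn φ (Set.Ioo 0 (Real.pi / 2)))
    (hφ_pos : ∀ ω ∈ Set.Ioo 0 (Real.pi / 2), 0 < φ ω)
    (hφ : Filter.Tendsto (fun ω => φ ω / Real.tan ω ^ p) (𝓝[<] (Real.pi / 2)) (𝓝 0)) :
    Filter.limsup
      (fun ω : ℝ =>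
        ⨆ (a : ℓ^∞(ℤ, ℂ)) (b : ℓ^∞(ℤ, ℂ)) (c : ℓ^∞(ℤ, ℂ))
          (hv : Memℓp (JacobiLT.deviation a b c) (ENNReal.ofReal p))
          (_ : JacobiLT.deviation a b c ≠ 0),
          (ENNReal.ofReal
              (φ ω * ‖(⟨JacobiLT.deviation a b c, hv⟩ : ℓ^(ENNReal.ofReal p)(ℤ, ℝ))‖ ^ p))⁻¹ *
            JacobiLT.sectorSum p ω (JacobiLT.jacobi a b c))
      (𝓝[<] (Real.pi / 2)) = ∞ := by
  have hpi : Set.Ioo 0 (Real.pi / 2) ∈ 𝓝[<] (Real.pi / 2) :=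
    Ioo_mem_nhdsLT (half_pos Real.pi_pos)
  have hdiv : Filter.Tendsto (fun ω => Real.tan ω ^ p / φ ω / (6 * 4 ^ p))
      (𝓝[<] (Real.pi / 2)) Filter.atTop := by
    refine Filter.Tendsto.atTop_div_const (by positivity) ?_
    -- Positivity makes the convergence one-sided, so the reciprocal tends to `+∞`.
    have h1 : Filter.Tendsto (fun ω => φ ω / Real.tan ω ^ p) (𝓝[<] (Real.pi / 2)) (𝓝[>] 0) := by
      refine tendsto_nhdsWithin_iff.mpr ⟨hφ, ?_⟩
      filter_upwards [hpi] with ω hω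
      exact div_pos (hφ_pos ω hω)
        (Real.rpow_pos_of_pos (Real.tan_pos_of_pos_of_lt_pi_div_two hω.1 hω.2) p)
    exact h1.inv_tendsto_nhdsGT_zero.congr fun ω => inv_div _ _
  refine (tendsto_of_tendsto_of_tendsto_of_le_of_le' (ENNReal.tendsto_ofReal_nhds_top.mpr hdiv)
    tendsto_const_nhds ?_ (Filter.Eventually.of_forall fun _ => le_top)).limsup_eq
  filter_upwards [hpi, Real.tendsto_tan_pi_div_two.eventually_ge_atTop 4] with ω hω htan
  exact JacobiLT.ofReal_tan_rpow_div_le_iSup hp htan (hφ_pos ω hω)
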